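/- Let $\lg=\log_2$. A batch of $n$ packets simultaneously starts to contend for a channel using LogLog-Backoff: the window size $w$ takes the values $1,2,4,8,\dots$, and each window of size $w\ge 2$ is executed $\lg\lg w$ times (rounded to an integer $r(w)\ge 0$ in any way with $|r(w)-\lg\lg w|\le 1$; the window of size $1$ is executed any fixed number of times) before $w$ doubles. In every execution of a window of size $w$, each packet that has not yet succeeded chooses one of the $w$ slots of the window uniformly at random, independently of all other choices; the packet succeeds, and leaves, if no other remaining packet chose the same slot. A slot of an execution that is chosen by at least two remaining packets is a collision. Let $\mathcal C$ be the total number of collisions over the whole run. Then $\mathcal C=\Omega\!\left(\frac{n\lg\lg n}{\lg\lg\lg n}\right)$ with high probability: there is a constant $C>0$ such that for every $a>0$ there is an $N$ such that, for all $n\ge N$ and every such rounding $r$, $$\Pr\!\left[\mathcal C\ \ge\ C\,\frac{n\lg\lg n}{\lg\lg\lg n}\right]\ \ge\ 1-\frac1{n^{a}}.$$ -/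

import Mathlib

open MeasureTheory

noncomputable section

/-- Base-two logarithm. -/
def lg (x : ℝ) : ℝ := Real.logb 2 x

namespace LogLogBackoff

/-- The packets of `S` that remain after one execution of a window with `w` slots in which packet
`i` transmits in slot `s i`: a packet succeeds, and leaves, iff no other packet of `S` chose its
slot. -/
def survivors {n w : ℕ} (S : Finset (Fin n)) (s : Fin n → Fin w) : Finset (Fin n) :=
  {i ∈ S | ∃ j ∈ S, j ≠ i ∧ s j = s i}

/-- The number of collisions in one execution of a window with `w` slots: the number of slots
chosen by at least two of the packets of `S`. -/
def collisions {n w : ℕ} (S : Finset (Fin n)) (s : Fin n → Fin w) : ℕ :=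
  Finset.card {t : Fin w | 2 ≤ Finset.card {i ∈ S | s i = t}}

/-- All random choices: `ω (k, j, i)` is the slot that packet `i` picks in the `j`-th execution
(counted from `0`) of the window of size `2 ^ k`. Only the choices of packets that are still
present, in executions that take place, are ever used. -/
abbrev Choices (n : ℕ) : Type := (q : ℕ × ℕ × Fin n) → Fin (2 ^ q.1)

/-- The choices are independent, each one uniform over the slots of its window. -/
def law (n : ℕ) : Measure (Choices n) :=
  Measure.infinitePi fun q : ℕ × ℕ × Fin n => (PMF.uniformOfFintype (Fin (2 ^ q.1))).toMeasure

/-- The slots picked by the packets in the `j`-th execution of the window of size `2 ^ k`. -/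
def slots {n : ℕ} (ω : Choices n) (k j : ℕ) : Fin n → Fin (2 ^ k) := fun i => ω (k, j, i)

/-- The packets that remain after `j` executions of the window of size `2 ^ k`, if those in `S`
were present before the first of them. -/
def afterExecutions {n : ℕ} (ω : Choices n) (k : ℕ) (S : Finset (Fin n)) : ℕ → Finset (Fin n)
  | 0 => S
  | j + 1 => survivors (afterExecutions ω k S j) (slots ω k j)

/-- The packets present when the window size becomes `2 ^ k`. All `n` packets start with window
size `1`; a window of size `w` is executed `reps w` times, and then the size doubles. -/
def presentAt {n : ℕ} (reps : ℕ → ℕ) (ω : Choices n) : ℕ → Finset (Fin n)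
  | 0 => Finset.univ
  | k + 1 => afterExecutions ω k (presentAt reps ω k) (reps (2 ^ k))

/-- The total number of collisions over the whole run. -/
def totalCollisions {n : ℕ} (reps : ℕ → ℕ) (ω : Choices n) : ENNReal :=
  ∑' k : ℕ, ∑ j ∈ Finset.range (reps (2 ^ k)),
    (collisions (afterExecutions ω k (presentAt reps ω k) j) (slots ω k j) : ENNReal)

/-- `reps w` is `lg lg w`, rounded to an integer in some way (down, up, to the nearest, up to at
least `1`, ...). At `w = 1`, where `lg lg w` is undefined, any number of executions is allowed. -/
def IsLogLog (reps : ℕ → ℕ) : Prop :=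
  ∀ w : ℕ, 2 ≤ w → |(reps w : ℝ) - lg (lg w)| ≤ 1

end LogLogBackoff

end

open MeasureTheory

namespace LogLogBackoff

/-! Put `l = lg lg n`, `L = lg lg lg n`, let `t` be about `n / l²` and `2 ^ K` a power of two of
order `n / L`. Call a slot low if at most one packet chose it. The window `2 ^ K` alone yields
enough collisions. While at least half of the packets remain, an execution of a window of size at
most `2 ^ K` has fewer than `t` low slots, except with probability `exp (-t)`. Indeed `t` low slots
are avoided by all but at most `t` packets, and a load of order `L` packets per slot makes this rare
enough to pay for the choice of both sets (`law_real_lowSlots_le`, `choose_mul_choose_mul_pow_le`).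
Fixed packet sets suffice, since the past is independent of the current choices
(`law_real_alive_le`). Successes inject into low slots. One execution of each window shorter than
`t` loses `O(t)` packets in total, and only `O(L)` windows lie between `t` and `2 ^ K`; with about
`l` executions each, `O(t l L) = o(n)` packets leave (`le_two_mul_card_alive`,
`sum_min_two_pow_le`). So each of the roughly `l` executions of the window `2 ^ K` has at least `2 ^
K - t ≥ 2 ^ K / 2` collisions. -/

/-! ### Deterministic accounting of successes and collisions -/

/-- The slots chosen by at most one of the packets of `S`. -/
def lowSlots {n w : ℕ} (S : Finset (Fin n)) (s : Fin n → Fin w) : Finset (Fin w) :=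
  {t : Fin w | Finset.card {i ∈ S | s i = t} ≤ 1}

/-- The packets present before the `j`-th execution of the window of size `2 ^ k`. -/
def alive {n : ℕ} (reps : ℕ → ℕ) (ω : Choices n) (k j : ℕ) : Finset (Fin n) :=
  afterExecutions ω k (presentAt reps ω k) j

lemma alive_succ {n : ℕ} (reps : ℕ → ℕ) (ω : Choices n) (k j : ℕ) :
    alive reps ω k (j + 1) = survivors (alive reps ω k j) (slots ω k j) := rfl

lemma alive_zero_succ {n : ℕ} (reps : ℕ → ℕ) (ω : Choices n) (k : ℕ) :
    alive reps ω (k + 1) 0 = alive reps ω k (reps (2 ^ k)) := rfl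

lemma collisions_add_card_lowSlots {n w : ℕ} (S : Finset (Fin n)) (s : Fin n → Fin w) :
    collisions S s + (lowSlots S s).card = w := by
  have h := Finset.card_filter_add_card_filter_not (s := (Finset.univ : Finset (Fin w)))
    (fun t => 2 ≤ Finset.card {i ∈ S | s i = t})
  rw [Finset.card_univ, Fintype.card_fin] at h
  unfold collisions lowSlots
  convert h using 4
  omega

/-- A successful packet is alone in its slot, so the successes inject into the low slots. -/
lemma card_le_card_survivors_add {n w : ℕ} (S : Finset (Fin n)) (s : Fin n → Fin w) :
    S.card ≤ (survivors S s).card + (lowSlots S s).card := by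
  have h := Finset.card_filter_add_card_filter_not (s := S)
    (fun i => ∃ j ∈ S, j ≠ i ∧ s j = s i)
  have h2 : (S.filter fun i => ¬ ∃ j ∈ S, j ≠ i ∧ s j = s i).card ≤ (lowSlots S s).card := by
    refine Finset.card_le_card_of_injOn s ?_ ?_
    · intro i hi
      simp only [Finset.coe_filter, Set.mem_ofPred_eq] at hi
      simp only [lowSlots, Finset.coe_filter, Finset.mem_univ, true_and, Set.mem_ofPred_eq]
      refine Finset.card_le_one.2 fun a ha b hb => ?_
      simp only [Finset.mem_filter] at ha hb
      by_contra hab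
      apply hi.2
      by_cases hai : a = i
      · exact ⟨b, hb.1, fun h => hab (hai.trans h.symm), hb.2⟩
      · exact ⟨a, ha.1, hai, ha.2⟩
    · intro i hi j hj hij
      simp only [Finset.coe_filter, Set.mem_ofPred_eq] at hi hj
      by_contra hne
      exact hi.2 ⟨j, hj.1, fun h => hne h.symm, hij.symm⟩
  unfold survivors
  omega

lemma survivors_eq_of_subsingleton {n w : ℕ} [Subsingleton (Fin w)] (S : Finset (Fin n))
    (s : Fin n → Fin w) (hS : 2 ≤ S.card) : survivors S s = S := by
  refine Finset.filter_true_of_mem fun i _ => ?_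
  obtain ⟨j, hj, hne⟩ := Finset.exists_mem_ne (by omega : 1 < S.card) i
  exact ⟨j, hj, hne, Subsingleton.elim _ _⟩

/-- With a single slot and two or more packets everyone collides, so the arbitrary repetition count
at window size `1` is harmless. -/
lemma alive_zero {n : ℕ} (hn : 2 ≤ n) (reps : ℕ → ℕ) (ω : Choices n) (j : ℕ) :
    alive reps ω 0 j = Finset.univ := by
  induction j with
  | zero => rfl
  | succ j ih =>
    have : Subsingleton (Fin (2 ^ 0)) := by rw [pow_zero]; infer_instance
    rw [alive_succ, ih]
    exact survivors_eq_of_subsingleton _ _ (by simpa using hn)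

/-- If an execution of a window of size `2 ^ k`, `1 ≤ k ≤ K`, that starts with at least half of
the packets has at most `t` slots with at most one packet, and the resulting bounds on the numbers
of successes add up to at most half of the packets, then at least half of the packets are present
throughout. -/
lemma le_two_mul_card_alive {n : ℕ} (hn : 2 ≤ n) (reps : ℕ → ℕ) (ω : Choices n) (K t : ℕ)
    (hgood : ∀ k, 1 ≤ k → k ≤ K → ∀ j < reps (2 ^ k), n ≤ 2 * (alive reps ω k j).card →
      (lowSlots (alive reps ω k j) (slots ω k j)).card ≤ t)
    (hsum : 2 * ∑ k ∈ Finset.Icc 1 K, reps (2 ^ k) * min (2 ^ k) t ≤ n) {k j : ℕ}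
    (hk1 : 1 ≤ k) (hkK : k ≤ K) (hj : j ≤ reps (2 ^ k)) :
    n ≤ 2 * (alive reps ω k j).card := by
  -- The induction carries the exact running loss: `hgood` applies only while half of the packets
  -- remain, and this is recovered at each step by comparing the loss so far with `hsum`.
  have key : ∀ k, 1 ≤ k → k ≤ K → ∀ j ≤ reps (2 ^ k), n ≤ (alive reps ω k j).card +
      (∑ i ∈ Finset.Ico 1 k, reps (2 ^ i) * min (2 ^ i) t + j * min (2 ^ k) t) := by
    intro k hk1
    induction k, hk1 using Nat.le_induction with
    | base =>
      intro hK j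
      induction j with
      | zero => intro _; rw [alive_zero_succ, alive_zero hn]; simp
      | succ j ih =>
        intro hj
        have h1 := ih (by omega)
        have hle : reps (2 ^ 1) * min (2 ^ 1) t ≤
            ∑ k ∈ Finset.Icc 1 K, reps (2 ^ k) * min (2 ^ k) t :=
          Finset.single_le_sum (f := fun k => reps (2 ^ k) * min (2 ^ k) t)
            (fun _ _ => Nat.zero_le _) (Finset.mem_Icc.2 ⟨le_rfl, hK⟩)
        have hle2 : j * min (2 ^ 1) t ≤ reps (2 ^ 1) * min (2 ^ 1) t :=
          Nat.mul_le_mul_right _ (by omega)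
        simp only [Finset.Ico_self, Finset.sum_empty, zero_add] at h1 ⊢
        have h2 := hgood 1 le_rfl hK j (by omega) (by omega)
        have h3 := card_le_card_survivors_add (alive reps ω 1 j) (slots ω 1 j)
        -- A window has at most as many low slots as slots; this supplies the other half of the
        -- `min`.
        have h4 := collisions_add_card_lowSlots (alive reps ω 1 j) (slots ω 1 j)
        have h5 : (lowSlots (alive reps ω 1 j) (slots ω 1 j)).card ≤ min (2 ^ 1) t :=
          le_min (by omega) h2
        rw [alive_succ, Nat.succ_mul]
        omega
    | succ k hk ihk =>
      intro hK j
      induction j with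
      | zero =>
        intro _
        have := ihk (by omega) _ le_rfl
        rw [alive_zero_succ, Finset.sum_Ico_succ_top hk]
        omega
      | succ j ih =>
        intro hj
        have h1 := ih (by omega)
        have hle : ∑ i ∈ Finset.Ico 1 (k + 1 + 1), reps (2 ^ i) * min (2 ^ i) t ≤
            ∑ k ∈ Finset.Icc 1 K, reps (2 ^ k) * min (2 ^ k) t := by
          refine Finset.sum_le_sum_of_subset fun x hx => ?_
          simp only [Finset.mem_Ico, Finset.mem_Icc] at hx ⊢
          omega
        rw [Finset.sum_Ico_succ_top (by omega)] at hle
        have hle2 : j * min (2 ^ (k + 1)) t ≤ reps (2 ^ (k + 1)) * min (2 ^ (k + 1)) t :=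
          Nat.mul_le_mul_right _ (by omega)
        have h2 := hgood (k + 1) (by omega) hK j (by omega) (by omega)
        have h3 := card_le_card_survivors_add (alive reps ω (k + 1) j) (slots ω (k + 1) j)
        have h4 := collisions_add_card_lowSlots (alive reps ω (k + 1) j) (slots ω (k + 1) j)
        have h5 : (lowSlots (alive reps ω (k + 1) j) (slots ω (k + 1) j)).card ≤
            min (2 ^ (k + 1)) t := le_min (by omega) h2
        rw [alive_succ, Nat.succ_mul]
        omega
  have h := key k hk1 hkK j hj
  have hle : ∑ i ∈ Finset.Ico 1 (k + 1), reps (2 ^ i) * min (2 ^ i) t ≤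
      ∑ k ∈ Finset.Icc 1 K, reps (2 ^ k) * min (2 ^ k) t := by
    refine Finset.sum_le_sum_of_subset fun x hx => ?_
    simp only [Finset.mem_Ico, Finset.mem_Icc] at hx ⊢
    omega
  rw [Finset.sum_Ico_succ_top hk1] at hle
  have hle2 : j * min (2 ^ k) t ≤ reps (2 ^ k) * min (2 ^ k) t :=
    Nat.mul_le_mul_right _ hj
  omega

/-- All terms of the series except window `2 ^ K` are dropped; there every slot that is not low is a
collision. -/
lemma mul_le_totalCollisions {n : ℕ} (hn : 2 ≤ n) (reps : ℕ → ℕ) (ω : Choices n) (K t : ℕ)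
    (hK : 1 ≤ K)
    (hgood : ∀ k, 1 ≤ k → k ≤ K → ∀ j < reps (2 ^ k), n ≤ 2 * (alive reps ω k j).card →
      (lowSlots (alive reps ω k j) (slots ω k j)).card ≤ t)
    (hsum : 2 * ∑ k ∈ Finset.Icc 1 K, reps (2 ^ k) * min (2 ^ k) t ≤ n) :
    ((reps (2 ^ K) * (2 ^ K - t) : ℕ) : ENNReal) ≤ totalCollisions reps ω := by
  refine le_trans ?_ (ENNReal.le_tsum K)
  rw [← Nat.cast_sum, Nat.cast_le, ← smul_eq_mul]
  conv_lhs => rw [← Finset.card_range (reps (2 ^ K))]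
  refine Finset.card_nsmul_le_sum _ _ _ fun j hj => ?_
  rw [Finset.mem_range] at hj
  have h := hgood K hK le_rfl j hj
    (le_two_mul_card_alive hn reps ω K t hgood hsum hK le_rfl hj.le)
  have h2 := collisions_add_card_lowSlots (alive reps ω K j) (slots ω K j)
  unfold alive at h h2
  omega

/-! ### Probability of many low slots in one execution -/

/-- The packets present before the `j`-th execution of the window of size `2 ^ k` are determined by
the choices made in earlier executions. -/
lemma alive_congr {n : ℕ} (reps : ℕ → ℕ) (ω η : Choices n) (k j : ℕ)
    (h : ∀ k₁ j₁ i, (k₁ < k ∧ j₁ < reps (2 ^ k₁)) ∨ (k₁ = k ∧ j₁ < j) →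
      ω (k₁, j₁, i) = η (k₁, j₁, i)) :
    alive reps ω k j = alive reps η k j := by
  induction k generalizing j with
  | zero =>
    induction j with
    | zero => rfl
    | succ j ih =>
      have hs : slots ω 0 j = slots η 0 j := by
        funext i; exact h _ _ _ (Or.inr ⟨rfl, by omega⟩)
      rw [alive_succ, alive_succ, hs, ih]
      intro k₁ j₁ i hk
      exact h _ _ _ (by omega)
  | succ k ihk =>
    induction j with
    | zero =>
      rw [alive_zero_succ, alive_zero_succ]
      refine ihk _ fun k₁ j₁ i hk => h _ _ _ (Or.inl ?_)
      rcases hk with hk | ⟨rfl, hk⟩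
      · exact ⟨by omega, hk.2⟩
      · exact ⟨by omega, hk⟩
    | succ j ih =>
      have hs : slots ω (k + 1) j = slots η (k + 1) j := by
        funext i; exact h _ _ _ (Or.inr ⟨rfl, by omega⟩)
      rw [alive_succ, alive_succ, hs, ih]
      intro k₁ j₁ i hk
      refine h _ _ _ (hk.imp id fun hk => ⟨hk.1, by omega⟩)


instance isProbabilityMeasure_law (n : ℕ) : IsProbabilityMeasure (law n) := by
  unfold law; infer_instance

/-- The probability that the packets of `F` all avoid the slots of `T`. -/
lemma law_real_avoid {n : ℕ} (k j : ℕ) (F : Finset (Fin n)) (T : Finset (Fin (2 ^ k))) :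
    (law n).real {ω | ∀ i ∈ F, slots ω k j i ∉ T} = (1 - (T.card : ℝ) / 2 ^ k) ^ F.card := by
  classical
  let e : Fin n ↪ ℕ × ℕ × Fin n := ⟨fun i => (k, j, i), fun a b h => by simpa using h⟩
  -- The type of a slot varies with `q`, so membership in `T` is expressed through values in `ℕ`.
  let U : (q : ℕ × ℕ × Fin n) → Set (Fin (2 ^ q.1)) := fun q =>
    {x | ∀ y ∈ T, (y : ℕ) ≠ x}
  have hset : {ω : Choices n | ∀ i ∈ F, slots ω k j i ∉ T} = Set.pi (F.map e) U := by
    ext ω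
    simp only [Set.mem_ofPred_eq, Set.mem_pi, Finset.coe_map, Set.mem_image, Finset.mem_coe,
      forall_exists_index, and_imp, forall_apply_eq_imp_iff₂, U]
    refine forall₂_congr fun i _ => ⟨fun h y hy hyx => h ?_, fun h hm => h _ hm rfl⟩
    have : y = slots ω k j i := Fin.ext hyx
    rwa [← this]
  rw [hset, Measure.real, law, Measure.infinitePi_pi _ (fun _ _ => MeasurableSet.of_discrete),
    Finset.prod_map, ENNReal.toReal_prod]
  rw [← Finset.prod_const]
  refine Finset.prod_congr rfl fun i _ => ?_
  have hU : U (e i) = ((Tᶜ : Finset (Fin (2 ^ k))) : Set (Fin (2 ^ k))) := by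
    ext x
    simp only [U, Set.mem_ofPred_eq, Finset.coe_compl, Set.mem_compl_iff, Finset.mem_coe]
    exact ⟨fun h hm => h _ hm rfl, fun h y hy hyx => h (by rwa [← Fin.ext hyx])⟩
  rw [hU]
  change ((PMF.uniformOfFintype (Fin (2 ^ k))).toMeasure
    ((Tᶜ : Finset (Fin (2 ^ k))) : Set (Fin (2 ^ k)))).toReal = _
  rw [PMF.toMeasure_uniformOfFintype_apply _ MeasurableSet.of_discrete]
  have hT : T.card ≤ 2 ^ k := by simpa using Finset.card_le_univ T
  simp only [Fintype.card_coe, Finset.coe_sort_coe, Finset.card_compl, Fintype.card_fin,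
    ENNReal.toReal_div, ENNReal.toReal_natCast]
  rw [Nat.cast_sub hT]
  push_cast
  field_simp

/-- The probability that at least `t` slots are chosen by at most one packet of a fixed set. -/
lemma law_real_lowSlots_le {n : ℕ} (k j t : ℕ) (S : Finset (Fin n)) (ht : t ≤ S.card) :
    (law n).real {ω | t ≤ (lowSlots S (slots ω k j)).card} ≤
      ((2 ^ k).choose t : ℝ) * (S.card.choose t) * (1 - (t : ℝ) / 2 ^ k) ^ (S.card - t) := by
  classical
  -- Union bound over pairs `(T, A)`: `T` consists of `t` low slots, and `A` of `t` packets
  -- including all those that hit `T`. There are at most `t` of the latter, one per low slot.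
  let P := (Finset.univ : Finset (Fin (2 ^ k))).powersetCard t ×ˢ S.powersetCard t
  have hsub : {ω : Choices n | t ≤ (lowSlots S (slots ω k j)).card} ⊆
      ⋃ p ∈ P, {ω | ∀ i ∈ S \ p.2, slots ω k j i ∉ p.1} := by
    intro ω hω
    obtain ⟨T, hT, hTc⟩ := Finset.exists_subset_card_eq (Set.mem_ofPred_eq ▸ hω)
    have hA : (S.filter fun i => slots ω k j i ∈ T).card ≤ t := by
      have := Finset.card_le_mul_card_image_of_maps_to
        (s := S.filter fun i => slots ω k j i ∈ T) (t := T) (f := slots ω k j)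
        (fun i hi => (Finset.mem_filter.1 hi).2) 1 (fun b hb => by
          have h1 := hT hb
          simp only [lowSlots, Finset.mem_filter, Finset.mem_univ, true_and] at h1
          refine le_trans (Finset.card_le_card fun i hi => ?_) h1
          simp only [Finset.mem_filter] at hi ⊢
          exact ⟨hi.1.1, hi.2⟩)
      omega
    obtain ⟨A, hA1, hA2, hA3⟩ :=
      Finset.exists_subsuperset_card_eq (Finset.filter_subset _ S) hA ht
    simp only [Set.mem_iUnion]
    refine ⟨(T, A), ?_, ?_⟩
    · simp only [P, Finset.mem_product, Finset.mem_powersetCard]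
      exact ⟨⟨Finset.subset_univ _, hTc⟩, hA2, hA3⟩
    · intro i hi hiT
      rw [Finset.mem_sdiff] at hi
      exact hi.2 (hA1 (Finset.mem_filter.2 ⟨hi.1, hiT⟩))
  refine (measureReal_mono hsub (measure_ne_top _ _)).trans
    ((measureReal_biUnion_finset_le _ _).trans ?_)
  have : ∀ p ∈ P, (law n).real {ω | ∀ i ∈ S \ p.2, slots ω k j i ∉ p.1} =
      (1 - (t : ℝ) / 2 ^ k) ^ (S.card - t) := by
    intro p hp
    simp only [P, Finset.mem_product, Finset.mem_powersetCard] at hp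
    rw [law_real_avoid, hp.1.2, Finset.card_sdiff_of_subset hp.2.1, hp.2.2]
  rw [Finset.sum_congr rfl this, Finset.sum_const, nsmul_eq_mul]
  simp [P, Finset.card_product, Finset.card_powersetCard]

lemma choose_le_div_mul_exp_pow {n m t : ℕ} (hmn : m ≤ n) (ht : 0 < t) :
    (m.choose t : ℝ) ≤ ((n : ℝ) / t * Real.exp 1) ^ t := by
  have h1 : (m.choose t : ℝ) ≤ (m : ℝ) ^ t / t.factorial := Nat.choose_le_pow_div t m
  have h2 := Real.pow_div_factorial_le_exp (t : ℝ) (Nat.cast_nonneg _) t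
  have h3 : (m : ℝ) ^ t ≤ (n : ℝ) ^ t := by gcongr
  have hf : (0 : ℝ) < t.factorial := by positivity
  have htp : (0 : ℝ) < (t : ℝ) ^ t := by positivity
  rw [mul_pow, ← Real.exp_nat_mul, mul_one, div_pow]
  calc (m.choose t : ℝ) ≤ (n : ℝ) ^ t / t.factorial := h1.trans (by gcongr)
    _ = (n : ℝ) ^ t / (t : ℝ) ^ t * ((t : ℝ) ^ t / t.factorial) := by field_simp
    _ ≤ _ := by gcongr

/-- Each binomial is at most `(e n / t) ^ t`, and `m - t ≥ n / 4` bounds the power by `exp (-n / (4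
w)) ^ t`. In `exp 3`, two factors `e` pay for the binomials and the third leaves `exp (-t)`. -/
lemma choose_mul_choose_mul_pow_le {n m w t : ℕ} (ht : 0 < t) (htw : t ≤ w) (hwn : w ≤ n)
    (hmn : m ≤ n) (hnm : n ≤ 2 * m) (htn : 4 * t ≤ n)
    (hexp : Real.exp 3 * ((n : ℝ) / t) ^ 2 ≤ Real.exp (n / (4 * w))) :
    (w.choose t : ℝ) * (m.choose t) * (1 - (t : ℝ) / w) ^ (m - t) ≤ Real.exp (-t) := by
  have hw : (0 : ℝ) < w := by exact_mod_cast ht.trans_le htw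
  have h0 : (0 : ℝ) ≤ 1 - (t : ℝ) / w := by
    rw [sub_nonneg, div_le_one hw]; exact_mod_cast htw
  have hmt : (n : ℝ) / 4 ≤ ((m - t : ℕ) : ℝ) := by
    have : n ≤ 4 * (m - t) := by omega
    have : (n : ℝ) ≤ 4 * ((m - t : ℕ) : ℝ) := by exact_mod_cast this
    linarith
  have h1 : (1 - (t : ℝ) / w) ^ (m - t) ≤ Real.exp (-(n / (4 * w))) ^ t := by
    have : 1 - (t : ℝ) / w ≤ Real.exp (-((t : ℝ) / w)) := by
      have := Real.add_one_le_exp (-((t : ℝ) / w)); linarith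
    calc _ ≤ Real.exp (-((t : ℝ) / w)) ^ (m - t) := by gcongr
      _ = Real.exp (((m - t : ℕ) : ℝ) * -((t : ℝ) / w)) := (Real.exp_nat_mul _ _).symm
      _ ≤ Real.exp (t * -(n / (4 * w))) := by
        rw [Real.exp_le_exp, mul_neg, mul_neg, neg_le_neg_iff]
        calc (t : ℝ) * (n / (4 * w)) = n / 4 * (t / w) := by field_simp
          _ ≤ _ := by gcongr
      _ = _ := Real.exp_nat_mul _ _
  have h2 := choose_le_div_mul_exp_pow hwn ht
  have h3 := choose_le_div_mul_exp_pow hmn ht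
  calc _ ≤ ((n : ℝ) / t * Real.exp 1) ^ t * ((n : ℝ) / t * Real.exp 1) ^ t *
        Real.exp (-(n / (4 * w))) ^ t := by gcongr
    _ = (Real.exp (-1) * ((Real.exp 3 * ((n : ℝ) / t) ^ 2) * Real.exp (-(n / (4 * w))))) ^ t := by
      rw [← mul_pow, ← mul_pow]
      congr 1
      have : Real.exp 1 * Real.exp 1 = Real.exp (-1) * Real.exp 3 := by
        rw [← Real.exp_add, ← Real.exp_add]; norm_num
      linear_combination ((n : ℝ) / t) ^ 2 * Real.exp (-(n / (4 * w))) * this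
    _ ≤ (Real.exp (-1) * 1) ^ t := by
      gcongr
      calc _ ≤ Real.exp (n / (4 * w)) * Real.exp (-(n / (4 * w))) := by gcongr
        _ = 1 := by rw [← Real.exp_add]; simp
    _ = _ := by rw [mul_one, ← Real.exp_nat_mul]; simp

/-- The packets present before an execution are independent of the choices made in it, so that a
bound for every fixed set of packets holds for the random set as well. -/
lemma law_real_alive_le {n : ℕ} (reps : ℕ → ℕ) (k j : ℕ)
    (Q : Finset (Fin n) → (Fin n → Fin (2 ^ k)) → Prop) {ε : ℝ} (hε : 0 ≤ ε)
    (hQ : ∀ S, (law n).real {ω | Q S (slots ω k j)} ≤ ε) :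
    (law n).real {ω | Q (alive reps ω k j) (slots ω k j)} ≤ ε := by
  classical
  -- A crude bound exceeding every earlier execution index, so that finitely many coordinates `I`
  -- determine the past.
  let M := ∑ i ∈ Finset.range (k + 1), reps (2 ^ i) + j
  let I : Finset (ℕ × ℕ × Fin n) :=
    (Finset.range (k + 1) ×ˢ Finset.range M ×ˢ Finset.univ).filter fun q => ¬ (q.1 = k ∧ q.2.1 = j)
  let J : Finset (ℕ × ℕ × Fin n) := {k} ×ˢ {j} ×ˢ Finset.univ
  have hIJ : Disjoint I J := by
    rw [Finset.disjoint_left]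
    rintro ⟨a, b, i⟩ h1 h2
    simp only [I, J, Finset.mem_filter, Finset.mem_product, Finset.mem_singleton] at h1 h2
    exact h1.2 ⟨h2.1, h2.2.1⟩
  have hind : ProbabilityTheory.iIndepFun (fun (q : ℕ × ℕ × Fin n) (ω : Choices n) => ω q)
      (law n) :=
    ProbabilityTheory.iIndepFun_infinitePi (X := fun q : ℕ × ℕ × Fin n => (id : Fin (2 ^ q.1) → _))
      (fun _ => measurable_id)
  have hind2 := hind.indepFun_finset I J hIJ (fun q => measurable_pi_apply q)
  -- The filler slot `0` outside `I` does not affect the set of packets present, by `alive_congr`.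
  let extend : ((q : I) → Fin (2 ^ q.1.1)) → Choices n := fun x q =>
    if h : q ∈ I then x ⟨q, h⟩ else ⟨0, by positivity⟩
  have hJ : ∀ i, (k, j, i) ∈ J := fun i => by simp [J]
  let a : ((q : I) → Fin (2 ^ q.1.1)) → Finset (Fin n) := fun x => alive reps (extend x) k j
  let b : ((q : J) → Fin (2 ^ q.1.1)) → Fin n → Fin (2 ^ k) := fun x i => x ⟨(k, j, i), hJ i⟩
  have ha : ∀ ω : Choices n, alive reps ω k j = a fun q => ω q := by
    intro ω
    refine alive_congr _ _ _ _ _ fun k₁ j₁ i h => ?_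
    have hm : (k₁, j₁, i) ∈ I := by
      simp only [I, M, Finset.mem_filter, Finset.mem_product, Finset.mem_range, Finset.mem_univ,
        and_true]
      rcases h with h | h
      · have := Finset.single_le_sum (f := fun i => reps (2 ^ i)) (fun _ _ => Nat.zero_le _)
          (Finset.mem_range.2 (by omega : k₁ < k + 1))
        omega
      · omega
    simp [extend, hm]
  have hsplit : {ω : Choices n | Q (alive reps ω k j) (slots ω k j)} ⊆
      ⋃ S ∈ (Finset.univ : Finset (Finset (Fin n))),
        ((fun (ω : Choices n) (q : I) => ω q) ⁻¹' {x | a x = S} ∩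
          (fun (ω : Choices n) (q : J) => ω q) ⁻¹' {y | Q S (b y)}) := by
    intro ω hω
    simp only [Set.mem_iUnion]
    refine ⟨alive reps ω k j, Finset.mem_univ _, (ha ω).symm, hω⟩
  refine (measureReal_mono hsplit (measure_ne_top _ _)).trans
    ((measureReal_biUnion_finset_le _ _).trans ?_)
  have hmul : ∀ S : Finset (Fin n),
      (law n).real ((fun (ω : Choices n) (q : I) => ω q) ⁻¹' {x | a x = S} ∩
          (fun (ω : Choices n) (q : J) => ω q) ⁻¹' {y | Q S (b y)}) ≤
        (law n).real ((fun (ω : Choices n) (q : I) => ω q) ⁻¹' {x | a x = S}) * ε := by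
    intro S
    rw [Measure.real, hind2.measure_inter_preimage_eq_mul _ _ MeasurableSet.of_discrete
      MeasurableSet.of_discrete, ENNReal.toReal_mul]
    exact mul_le_mul_of_nonneg_left (hQ S) ENNReal.toReal_nonneg
  refine (Finset.sum_le_sum fun S _ => hmul S).trans ?_
  -- The events that the packets present are exactly `S` are disjoint, so their probabilities sum to
  -- at most `1`.
  rw [← Finset.sum_mul, ← measureReal_biUnion_finset]
  · exact mul_le_of_le_one_left hε measureReal_le_one
  · intro S _ T _ hST
    refine Set.disjoint_left.2 fun ω h1 h2 => hST ?_
    exact h1.symm.trans h2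
  · intro S _
    exact MeasurableSet.of_discrete.preimage
      (measurable_pi_lambda _ fun q => measurable_pi_apply _)

/-- The event that an execution starting with at least half of the packets has at least `t` slots
with at most one packet. -/
def badExecution {n : ℕ} (reps : ℕ → ℕ) (t k j : ℕ) : Set (Choices n) :=
  {ω | n ≤ 2 * (alive reps ω k j).card ∧ t ≤ (lowSlots (alive reps ω k j) (slots ω k j)).card}

lemma law_real_badExecution_le {n : ℕ} (reps : ℕ → ℕ) {t k : ℕ} (j : ℕ) (ht : 0 < t)
    (hwn : 2 ^ k ≤ n) (htn : 4 * t ≤ n)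
    (hexp : Real.exp 3 * ((n : ℝ) / t) ^ 2 ≤ Real.exp (n / (4 * 2 ^ k))) :
    (law n).real (badExecution reps t k j) ≤ Real.exp (-t) := by
  refine law_real_alive_le reps k j
    (fun S s => n ≤ 2 * S.card ∧ t ≤ (lowSlots S s).card) (Real.exp_nonneg _) fun S => ?_
  by_cases hS : n ≤ 2 * S.card ∧ t ≤ 2 ^ k
  · refine (measureReal_mono fun ω hω => hω.2).trans
      ((law_real_lowSlots_le k j t S (by omega)).trans ?_)
    have := choose_mul_choose_mul_pow_le (m := S.card) ht hS.2 hwn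
      (by simpa using Finset.card_le_univ S) hS.1 htn (by push_cast; exact hexp)
    push_cast at this
    exact this
  -- With too few packets, or fewer than `t` slots, the event is empty.
  · convert Real.exp_nonneg (-(t : ℝ))
    convert measureReal_empty
    ext ω
    simp only [Set.mem_ofPred_eq, Set.mem_empty_iff_false, iff_false]
    intro h
    have := collisions_add_card_lowSlots S (slots ω k j)
    exact hS ⟨h.1, by omega⟩


/-! ### Window sums and logarithm estimates -/

/-- Windows of size at most `t` form a geometric series bounded by `2 t`; each later one contributes
`t`. -/
lemma sum_min_two_pow_le (K t : ℕ) (ht : 0 < t) :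
    ∑ k ∈ Finset.Icc 1 K, min (2 ^ k) t ≤ t * (2 + (K - Nat.log 2 t)) := by
  have hsub : Finset.Icc 1 K ⊆ Finset.range (Nat.log 2 t + 1) ∪ Finset.Ioc (Nat.log 2 t) K := by
    intro x hx
    simp only [Finset.mem_union, Finset.mem_range, Finset.mem_Ioc, Finset.mem_Icc] at hx ⊢
    omega
  have h1 : ∑ k ∈ Finset.range (Nat.log 2 t + 1), min (2 ^ k) t ≤ 2 * t := by
    calc _ ≤ ∑ k ∈ Finset.range (Nat.log 2 t + 1), 2 ^ k :=
          Finset.sum_le_sum fun k _ => min_le_left _ _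
      _ = 2 ^ (Nat.log 2 t + 1) - 1 := by rw [Nat.geomSum_eq le_rfl]; simp
      _ ≤ 2 * t := by
        have := Nat.pow_log_le_self 2 ht.ne'
        rw [pow_succ]; omega
  have h2 : ∑ k ∈ Finset.Ioc (Nat.log 2 t) K, min (2 ^ k) t ≤ (K - Nat.log 2 t) * t := by
    calc _ ≤ ∑ k ∈ Finset.Ioc (Nat.log 2 t) K, t := Finset.sum_le_sum fun k _ => min_le_right _ _
      _ = _ := by simp
  calc _ ≤ ∑ k ∈ Finset.range (Nat.log 2 t + 1) ∪ Finset.Ioc (Nat.log 2 t) K, min (2 ^ k) t :=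
        Finset.sum_le_sum_of_subset hsub
    _ ≤ _ := Finset.sum_union_inter (s₁ := Finset.range (Nat.log 2 t + 1))
        (s₂ := Finset.Ioc (Nat.log 2 t) K) (f := fun k => min (2 ^ k) t) ▸ Nat.le_add_right _ _
    _ ≤ 2 * t + (K - Nat.log 2 t) * t := add_le_add h1 h2
    _ = _ := by ring

lemma lg_two_pow (k : ℕ) : lg ((2 ^ k : ℕ) : ℝ) = k := by
  unfold lg
  push_cast
  rw [Real.logb_pow, Real.logb_self_eq_one one_lt_two, mul_one]

lemma lg_le_lg {x y : ℝ} (hx : 0 < x) (hxy : x ≤ y) : lg x ≤ lg y :=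
  Real.logb_le_logb_of_le one_lt_two hx hxy

lemma log_eq_log_two_mul_lg (x : ℝ) : Real.log x = Real.log 2 * lg x := by
  unfold lg Real.logb
  have : Real.log 2 ≠ 0 := (Real.log_pos one_lt_two).ne'
  field_simp

lemma log_le_lg {x : ℝ} (hx : 1 ≤ x) : Real.log x ≤ lg x := by
  rw [log_eq_log_two_mul_lg]
  have h : 0 ≤ lg x := Real.logb_nonneg one_lt_two hx
  nlinarith [Real.log_two_lt_d9]

lemma lg_le_self {x : ℝ} (hx : 0 < x) : lg x ≤ x := by
  have h1 : x ≤ 2 ^ x := by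
    have h5 : (2 : ℝ) ^ (⌊x⌋₊ : ℝ) ≤ 2 ^ x :=
      Real.rpow_le_rpow_of_exponent_le one_le_two (Nat.floor_le hx.le)
    rw [Real.rpow_natCast] at h5
    have h6 := one_add_mul_le_pow (by norm_num : (-2 : ℝ) ≤ 1) ⌊x⌋₊
    have := Nat.lt_floor_add_one x
    norm_num at h6
    linarith
  unfold lg
  rwa [Real.logb_le_iff_le_rpow one_lt_two hx]

lemma IsLogLog.reps_le {reps : ℕ → ℕ} (h : IsLogLog reps) {k : ℕ} (hk : 1 ≤ k) :
    (reps (2 ^ k) : ℝ) ≤ lg k + 1 := by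
  have := abs_le.1 (h (2 ^ k) (by simpa using Nat.pow_le_pow_right two_pos hk))
  rw [lg_two_pow] at this
  linarith

lemma IsLogLog.le_reps {reps : ℕ → ℕ} (h : IsLogLog reps) {k : ℕ} (hk : 1 ≤ k) :
    lg k - 1 ≤ (reps (2 ^ k) : ℝ) := by
  have := abs_le.1 (h (2 ^ k) (by simpa using Nat.pow_le_pow_right two_pos hk))
  rw [lg_two_pow] at this
  linarith

/-! ### Union bound and choice of parameters -/

/-- With probability at least `1 - p`, where `p` bounds the union of all the bad events, the window
of size `2 ^ K` alone has many collisions. -/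
lemma one_sub_le_law {n : ℕ} (hn : 2 ≤ n) (reps : ℕ → ℕ) {K t : ℕ} (hK : 1 ≤ K) (ht : 0 < t)
    (hwn : 2 ^ K ≤ n) (htn : 4 * t ≤ n)
    (hexp : Real.exp 3 * ((n : ℝ) / t) ^ 2 ≤ Real.exp (n / (4 * 2 ^ K)))
    (hsum : 2 * ∑ k ∈ Finset.Icc 1 K, reps (2 ^ k) * min (2 ^ k) t ≤ n) {p : ℝ}
    (hp : (∑ k ∈ Finset.Icc 1 K, reps (2 ^ k) : ℕ) * Real.exp (-t) ≤ p) :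
    ENNReal.ofReal (1 - p) ≤ law n
      {ω | ((reps (2 ^ K) * (2 ^ K - t) : ℕ) : ENNReal) ≤ totalCollisions reps ω} := by
  classical
  let E : Set (Choices n) :=
    ⋃ k ∈ Finset.Icc 1 K, ⋃ j ∈ Finset.range (reps (2 ^ k)), badExecution reps t k j
  have hE : (law n).real E ≤ p := by
    refine le_trans ?_ hp
    refine (measureReal_biUnion_finset_le _ _).trans ?_
    rw [Nat.cast_sum, Finset.sum_mul]
    refine Finset.sum_le_sum fun k hk => (measureReal_biUnion_finset_le _ _).trans ?_
    rw [Finset.mem_Icc] at hk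
    have h2k : 2 ^ k ≤ 2 ^ K := Nat.pow_le_pow_right two_pos hk.2
    have h2k_real : (2 : ℝ) ^ k ≤ 2 ^ K := by exact_mod_cast h2k
    calc _ ≤ ∑ j ∈ Finset.range (reps (2 ^ k)), Real.exp (-t) :=
          Finset.sum_le_sum fun j _ => law_real_badExecution_le reps j ht (h2k.trans hwn) htn
            (hexp.trans (Real.exp_le_exp.2 (by gcongr)))
      _ = _ := by simp
  have hsub : Eᶜ ⊆
      {ω | ((reps (2 ^ K) * (2 ^ K - t) : ℕ) : ENNReal) ≤ totalCollisions reps ω} := by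
    intro ω hω
    refine mul_le_totalCollisions hn reps ω K t hK (fun k hk hkK j hj hc => ?_) hsum
    by_contra hlow
    refine hω ?_
    simp only [E, Set.mem_iUnion]
    exact ⟨k, Finset.mem_Icc.2 ⟨hk, hkK⟩, j, Finset.mem_range.2 hj, hc, by omega⟩
  refine le_trans ?_ (measure_mono hsub)
  have h1 : 1 ≤ (law n).real E + (law n).real Eᶜ := by
    have := measureReal_union_le (μ := law n) E Eᶜ
    rwa [Set.union_compl_self, probReal_univ] at this
  exact ENNReal.ofReal_le_of_le_toReal (by change _ ≤ (law n).real Eᶜ; linarith)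

/-- Bounding the number of successes in each execution of a window of size `2 ^ k` by
`min (2 ^ k) t`, at most half of the packets succeed up to the window of size `2 ^ K`. -/
lemma two_mul_sum_reps_mul_min_le {n K t : ℕ} {l : ℝ} {reps : ℕ → ℕ} (hn0 : (0 : ℝ) < n)
    (ht0 : 0 < t) (hL : 3 ≤ lg l) (hLl : 100 * lg l ≤ l) (hKy : (K : ℝ) ≤ lg n)
    (hnt : (n : ℝ) / t ≤ 2 * l ^ 2) (htl : (t : ℝ) * l ^ 2 ≤ n)
    (hrle : ∀ k ∈ Finset.Icc 1 K, (reps (2 ^ k) : ℝ) ≤ l + 1) :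
    2 * ∑ k ∈ Finset.Icc 1 K, reps (2 ^ k) * min (2 ^ k) t ≤ n := by
  have ht_pos : (0 : ℝ) < t := Nat.cast_pos.2 ht0
  have hl0 : 0 < l := by linarith
  have h1 : ((∑ k ∈ Finset.Icc 1 K, min (2 ^ k) t : ℕ) : ℝ) ≤ t * (4 + 2 * lg l) := by
    refine (Nat.cast_le.2 (sum_min_two_pow_le K t ht0)).trans ?_
    push_cast
    refine mul_le_mul_of_nonneg_left ?_ ht_pos.le
    have h2 : ((K - Nat.log 2 t : ℕ) : ℝ) ≤ 2 + 2 * lg l := by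
      have h3 : lg t ≤ Nat.log 2 t + 1 := by
        have := lg_le_lg ht_pos (Nat.cast_le.2 (Nat.lt_pow_succ_log_self one_lt_two t).le)
        rw [lg_two_pow] at this
        exact_mod_cast this
      have h4 : lg n - lg t ≤ 1 + 2 * lg l := by
        have h5 : lg (n / t) = lg n - lg t := Real.logb_div hn0.ne' ht_pos.ne'
        have h6 : lg (2 * l ^ 2) = 1 + 2 * lg l := by
          unfold lg
          rw [Real.logb_mul two_ne_zero (by positivity), Real.logb_self_eq_one one_lt_two,
            Real.logb_pow]
          push_cast
          ring
        rw [← h5, ← h6]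
        exact lg_le_lg (by positivity) hnt
      rcases le_total K (Nat.log 2 t) with h | h
      · rw [Nat.sub_eq_zero_of_le h, Nat.cast_zero]; linarith
      · rw [Nat.cast_sub h]; linarith
    linarith
  have h2 : ((∑ k ∈ Finset.Icc 1 K, reps (2 ^ k) * min (2 ^ k) t : ℕ) : ℝ) ≤
      (l + 1) * (t * (4 + 2 * lg l)) := by
    calc _ ≤ ∑ k ∈ Finset.Icc 1 K, (l + 1) * ((min (2 ^ k) t : ℕ) : ℝ) := by
          rw [Nat.cast_sum]
          refine Finset.sum_le_sum fun k hk => ?_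
          rw [Nat.cast_mul]
          exact mul_le_mul_of_nonneg_right (hrle k hk) (Nat.cast_nonneg _)
      _ = (l + 1) * ((∑ k ∈ Finset.Icc 1 K, min (2 ^ k) t : ℕ) : ℝ) := by
          rw [Nat.cast_sum, Finset.mul_sum]
      _ ≤ _ := by gcongr
  -- The total loss is of order `t l L`; this is where `t` of order `n / l²` is small enough.
  have h3 : 2 * ((l + 1) * (4 + 2 * lg l)) ≤ l ^ 2 := by nlinarith
  have h4 : 2 * ((l + 1) * (t * (4 + 2 * lg l))) ≤ (n : ℝ) := by
    calc _ = t * (2 * ((l + 1) * (4 + 2 * lg l))) := by ring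
      _ ≤ t * l ^ 2 := by gcongr
      _ ≤ n := htl
  have h5 : (2 : ℝ) * ((∑ k ∈ Finset.Icc 1 K, reps (2 ^ k) * min (2 ^ k) t : ℕ) : ℝ) ≤ n := by
    linarith
  rw [← Nat.cast_two, ← Nat.cast_mul] at h5
  exact Nat.cast_le.1 h5

/-- The union bound over all executions up to the window of size `2 ^ K`. -/
lemma sum_reps_mul_exp_neg_le {n K t : ℕ} {a l : ℝ} {reps : ℕ → ℕ} (ha : 0 < a)
    (hy : 1 ≤ lg n) (hy3n : 3 * lg n ^ 3 ≤ n) (hly : l ≤ lg n) (hKy : (K : ℝ) ≤ lg n)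
    (htlow : (a + 2) * lg n ≤ t) (hrle : ∀ k ∈ Finset.Icc 1 K, (reps (2 ^ k) : ℝ) ≤ l + 1) :
    (∑ k ∈ Finset.Icc 1 K, reps (2 ^ k) : ℕ) * Real.exp (-t) ≤ 1 / (n : ℝ) ^ a := by
  have hy0 : 0 < lg n := by linarith
  have hn0 : (0 : ℝ) < n := by linarith [pow_pos hy0 3]
  have hy2 : 1 ≤ lg n ^ 2 := one_le_pow₀ hy
  have hy3 : lg n ^ 2 ≤ lg n ^ 3 := pow_le_pow_right₀ hy (by norm_num)
  have hy1 : lg n ≤ lg n ^ 2 := by nlinarith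
  have h1 : ((∑ k ∈ Finset.Icc 1 K, reps (2 ^ k) : ℕ) : ℝ) ≤ n := by
    calc _ ≤ ∑ k ∈ Finset.Icc 1 K, (l + 1) := by
          rw [Nat.cast_sum]
          exact Finset.sum_le_sum hrle
      _ = K * (l + 1) := by rw [Finset.sum_const, Nat.card_Icc, nsmul_eq_mul, Nat.add_sub_cancel]
      _ ≤ K * (lg n + 1) := by gcongr
      _ ≤ lg n * (lg n + 1) := by gcongr
      _ ≤ n := by nlinarith
  have h2 : Real.log n ≤ lg n := log_le_lg (by linarith)
  calc _ ≤ (n : ℝ) * Real.exp (-t) := by gcongr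
    _ = Real.exp (Real.log n - t) := by
      rw [sub_eq_add_neg, Real.exp_add, Real.exp_log hn0]
    _ ≤ Real.exp (-(Real.log n * a)) := by
        -- One multiple of `log n` pays for the at most `n` executions, the other `a` give `n ^
        -- (-a)`.
        have h3 : Real.log n * (a + 1) ≤ lg n * (a + 1) := by gcongr
        exact Real.exp_le_exp.2 (by linarith)
    _ = _ := by rw [Real.exp_neg, Real.rpow_def_of_pos hn0, one_div]

/-- Here `w > n / (40 L)`, and `80 L ≤ l²` gives `t < w / 2`; the constant is `1/2 · 1/2 · 1/40`. -/
lemma mul_div_le_reps_mul_sub {n r t w : ℕ} {l L : ℝ} (hL : 3 ≤ L) (hLl : 100 * L ≤ l)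
    (hw : (n : ℝ) < 2 * w * (20 * L)) (htl : (t : ℝ) * l ^ 2 ≤ n) (hr : l / 2 ≤ r) :
    1 / 160 * (n * l / L) ≤ ((r * (w - t) : ℕ) : ℝ) := by
  have hL0 : 0 < L := by linarith
  have hl0 : 0 < l := by linarith
  have htw : (t : ℝ) < w / 2 := by
    have h1 : 80 * L ≤ l ^ 2 := by nlinarith
    have h2 : (t : ℝ) * (80 * L) ≤ n := le_trans (by gcongr) htl
    refine lt_of_mul_lt_mul_right (a := 80 * L) ?_ (by positivity)
    linarith
  have htw_nat : t ≤ w := by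
    have : (t : ℝ) ≤ w := by linarith
    exact_mod_cast this
  rw [Nat.cast_mul, Nat.cast_sub htw_nat]
  calc 1 / 160 * (n * l / L) ≤ 1 / 160 * ((2 * w * (20 * L)) * l / L) := by gcongr
    _ = l / 2 * ((w : ℝ) / 2) := by field_simp; ring
    _ ≤ _ := by gcongr; linarith

lemma one_sub_le_law_of_large {n : ℕ} {a : ℝ} (ha : 0 < a) {reps : ℕ → ℕ}
    (hreps : IsLogLog reps) (hL : 3 ≤ lg (lg (lg n))) (hLl : 100 * lg (lg (lg n)) ≤ lg (lg n))
    (hy : 1600 ≤ lg n) (hn : (a + 3) * lg n ^ 3 ≤ n) :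
    ENNReal.ofReal (1 - 1 / (n : ℝ) ^ a) ≤ law n
      {ω | ENNReal.ofReal (1 / 160 * (n * lg (lg n) / lg (lg (lg n)))) ≤
        totalCollisions reps ω} := by
  set y := lg n with hydef
  set l := lg y with hldef
  set L := lg l with hLdef
  have hl300 : 300 ≤ l := by linarith
  have hly : l ≤ y := lg_le_self (by linarith)
  have hy0 : 0 < y := by linarith
  have hl0 : 0 < l := by linarith
  have hL0 : 0 < L := by linarith
  have hy3n : 3 * y ^ 3 ≤ n := by
    have : 0 ≤ a * y ^ 3 := by positivity
    linarith
  have hyn : y ≤ n := by nlinarith [pow_pos hy0 3, pow_pos hy0 2]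
  have hn0 : (0 : ℝ) < n := by linarith
  have hn2 : 2 ≤ n := by
    have : (2 : ℝ) ≤ n := by linarith
    exact_mod_cast this
  set t := ⌊(n : ℝ) / l ^ 2⌋₊ with htdef
  have hX : (a + 3) * y ≤ n / l ^ 2 := by
    rw [le_div_iff₀ (by positivity)]
    calc (a + 3) * y * l ^ 2 ≤ (a + 3) * y * y ^ 2 := by gcongr
      _ = (a + 3) * y ^ 3 := by ring
      _ ≤ n := hn
  have hay : 0 < a * y := by positivity
  have htle : (t : ℝ) ≤ n / l ^ 2 := Nat.floor_le (by positivity)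
  have htlt : (n : ℝ) / l ^ 2 < t + 1 := Nat.lt_floor_add_one _
  have htlow : (a + 2) * y ≤ t := by nlinarith
  have ht1 : (1 : ℝ) ≤ t := by nlinarith
  have ht0 : 0 < t := by exact_mod_cast (by linarith : (0 : ℝ) < t)
  have ht_pos : (0 : ℝ) < t := by linarith
  have hnt : (n : ℝ) / t ≤ 2 * l ^ 2 := by
    rw [div_le_iff₀ ht_pos]
    rw [div_lt_iff₀ (by positivity)] at htlt
    nlinarith [sq_nonneg l]
  have htl : (t : ℝ) * l ^ 2 ≤ n := by rwa [le_div_iff₀ (by positivity)] at htle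
  have h4t : 4 * t ≤ n := by
    have : (4 : ℝ) * t ≤ n := by
      have h1 : (4 : ℝ) ≤ l ^ 2 := by nlinarith
      linarith [mul_le_mul_of_nonneg_left h1 ht_pos.le]
    exact_mod_cast this
  -- The factor `20` gives `n / (4 · 2 ^ K) ≥ 5 L`, which must exceed `3 + log (4 l ^ 4)`, about
  -- `2.8 L` plus a constant. Rounding down to a power of two costs at most a factor of order one.
  set K := Nat.log 2 ⌊(n : ℝ) / (20 * L)⌋₊ with hKdef
  have hLn : 20 * L ≤ n := by linarith
  have hfl : ⌊(n : ℝ) / (20 * L)⌋₊ ≠ 0 := by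
    rw [Ne, Nat.floor_eq_zero, not_lt, le_div_iff₀ (by positivity)]
    linarith
  have hw1 : ((2 ^ K : ℕ) : ℝ) ≤ n / (20 * L) :=
    (Nat.cast_le.2 (Nat.pow_log_le_self 2 hfl)).trans (Nat.floor_le (by positivity))
  have hw2 : (n : ℝ) / (20 * L) < 2 * (2 ^ K : ℕ) := by
    refine (Nat.lt_floor_add_one _).trans_le ?_
    have := Nat.lt_pow_succ_log_self one_lt_two ⌊(n : ℝ) / (20 * L)⌋₊
    rw [← hKdef, pow_succ] at this
    exact_mod_cast (by omega : ⌊(n : ℝ) / (20 * L)⌋₊ + 1 ≤ 2 * 2 ^ K)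
  have hw0 : (0 : ℝ) < (2 ^ K : ℕ) := by positivity
  rw [le_div_iff₀ (by positivity)] at hw1
  have hwn_real : ((2 ^ K : ℕ) : ℝ) ≤ n := by nlinarith
  have hwn : 2 ^ K ≤ n := by exact_mod_cast hwn_real
  have hKy : (K : ℝ) ≤ y := by
    rw [← lg_two_pow K]; exact lg_le_lg hw0 hwn_real
  -- Hence `lg K ≥ l - 1`, so the window `2 ^ K` is still executed about `l` times.
  have hKlow : y / 2 ≤ K := by
    have h1 : lg (n / (20 * L)) ≤ lg ((2 ^ (K + 1) : ℕ) : ℝ) :=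
      lg_le_lg (by positivity) (by rw [pow_succ]; push_cast at hw2 ⊢; linarith)
    rw [lg_two_pow] at h1
    have h2 : lg (n / (20 * L)) = y - lg (20 * L) :=
      Real.logb_div hn0.ne' (by positivity)
    have h3 : lg (20 * L) ≤ L := lg_le_lg (by positivity) (by linarith)
    push_cast at h1
    linarith
  have hK1 : 1 ≤ K := by
    have : (1 : ℝ) ≤ K := by linarith
    exact_mod_cast this
  have hlgK : l - 1 ≤ lg K := by
    have h1 : lg (y / 2) = l - 1 := by
      rw [hldef]
      unfold lg
      rw [Real.logb_div hy0.ne' two_ne_zero, Real.logb_self_eq_one one_lt_two]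
    rw [← h1]
    exact lg_le_lg (by positivity) hKlow
  have hrle : ∀ k ∈ Finset.Icc 1 K, (reps (2 ^ k) : ℝ) ≤ l + 1 := by
    intro k hk
    rw [Finset.mem_Icc] at hk
    refine (hreps.reps_le hk.1).trans (add_le_add_left (lg_le_lg ?_ ?_) 1)
    · exact_mod_cast hk.1
    · exact le_trans (by exact_mod_cast hk.2) hKy
  have hexp : Real.exp 3 * ((n : ℝ) / t) ^ 2 ≤ Real.exp (n / (4 * 2 ^ K)) := by
    have h1 : 5 * L ≤ n / (4 * 2 ^ K) := by
      rw [le_div_iff₀ (by positivity)]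
      push_cast at hw1
      linarith
    have h2 : Real.log (4 * l ^ 4) = Real.log 2 * (2 + 4 * L) := by
      rw [Real.log_mul (by norm_num) (by positivity), Real.log_pow, log_eq_log_two_mul_lg l,
        show (4 : ℝ) = 2 ^ 2 by norm_num, Real.log_pow]
      push_cast
      ring
    calc _ ≤ Real.exp 3 * (2 * l ^ 2) ^ 2 := by gcongr
      _ = Real.exp 3 * Real.exp (Real.log (4 * l ^ 4)) := by
        rw [Real.exp_log (by positivity)]; ring
      _ = Real.exp (3 + Real.log 2 * (2 + 4 * L)) := by rw [← Real.exp_add, h2]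
      _ ≤ _ := Real.exp_le_exp.2 (by nlinarith [Real.log_two_lt_d9])
  have hsum := two_mul_sum_reps_mul_min_le hn0 ht0 hL hLl hKy hnt htl hrle
  have hp := sum_reps_mul_exp_neg_le ha (by linarith) hy3n hly hKy htlow hrle
  refine (one_sub_le_law hn2 reps hK1 ht0 hwn h4t hexp hsum hp).trans (measure_mono fun ω hω => ?_)
  rw [Set.mem_ofPred_eq] at hω ⊢
  refine le_trans ?_ hω
  rw [← ENNReal.ofReal_natCast]
  refine ENNReal.ofReal_le_ofReal ?_
  rw [div_lt_iff₀ (by positivity)] at hw2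
  have hr := hreps.le_reps hK1
  exact mul_div_le_reps_mul_sub hL hLl hw2 htl (by linarith)

/-! ### Largeness conditions for the final threshold -/

lemma tendsto_lg_atTop : Filter.Tendsto lg Filter.atTop Filter.atTop :=
  Real.tendsto_logb_atTop one_lt_two

lemma eventually_mul_lg_pow_le (c : ℝ) (m : ℕ) : ∀ᶠ x in Filter.atTop, c * lg x ^ m ≤ x := by
  have h2 : 0 < Real.log 2 := Real.log_pos one_lt_two
  have hc : 0 < Real.log 2 ^ m / (|c| + 1) := by positivity
  filter_upwards [(Real.isLittleO_pow_log_id_atTop (n := m)).bound hc, Filter.eventually_ge_atTop 1]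
    with x hx hx1
  have hlg : 0 ≤ lg x := Real.logb_nonneg one_lt_two hx1
  rw [log_eq_log_two_mul_lg, Real.norm_of_nonneg (by positivity),
    Real.norm_of_nonneg (by simp only [id]; linarith), mul_pow, id, div_mul_eq_mul_div,
    le_div_iff₀ (by positivity), mul_assoc, mul_le_mul_iff_right₀ (by positivity)] at hx
  have : c ≤ |c| + 1 := by linarith [le_abs_self c]
  calc _ ≤ (|c| + 1) * lg x ^ m := by gcongr
    _ = lg x ^ m * (|c| + 1) := mul_comm _ _
    _ ≤ x := hx

end LogLogBackoff

theorem mainTheorem2 :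
    ∃ C : ℝ, 0 < C ∧ ∀ a : ℝ, 0 < a → ∃ N : ℕ,
      ∀ reps : ℕ → ℕ, LogLogBackoff.IsLogLog reps → ∀ n : ℕ, N ≤ n →
        ENNReal.ofReal (1 - 1 / (n : ℝ) ^ a) ≤
          LogLogBackoff.law n
            {ω | ENNReal.ofReal (C * (n * lg (lg n) / lg (lg (lg n)))) ≤
              LogLogBackoff.totalCollisions reps ω} := by
  refine ⟨1 / 160, by norm_num, fun a ha => ?_⟩
  have h0 := tendsto_natCast_atTop_atTop (R := ℝ)
  have h1 := LogLogBackoff.tendsto_lg_atTop.comp h0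
  have h2 := LogLogBackoff.tendsto_lg_atTop.comp h1
  have h3 := LogLogBackoff.tendsto_lg_atTop.comp h2
  -- The conditions involve only `n` and `a`, so `N` is uniform over all roundings.
  obtain ⟨N, hN⟩ := Filter.eventually_atTop.1
    ((h3.eventually_ge_atTop 3).and
      ((h2.eventually (LogLogBackoff.eventually_mul_lg_pow_le 100 1)).and
        ((h1.eventually_ge_atTop 1600).and
          (h0.eventually (LogLogBackoff.eventually_mul_lg_pow_le (a + 3) 3)))))
  refine ⟨N, fun reps hreps n hn => ?_⟩
  obtain ⟨hL, hLl, hy, hny⟩ := hN n hn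
  exact LogLogBackoff.one_sub_le_law_of_large ha hreps hL (by simpa using hLl) hy hny
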